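/- Let $\mathsf B$ be a locally presentable abelian category with a projective generator $P$, let $R$ be an associative unital ring, and let $\theta\colon R\to \mathrm{Hom}_{\mathsf B}(P,P)^{\mathrm{op}}$ be a (unital) ring homomorphism. Let $\Theta=\mathrm{Hom}_{\mathsf B}(P,-)\colon\mathsf B\to R\text{-}\mathrm{mod}$ be the resulting (exact) functor to the category of left $R$-modules, where $r\in R$ acts on $\mathrm{Hom}_{\mathsf B}(P,B)$ by precomposition with $\theta(r)$. Assume that $\Theta$ is fully faithful, and let $\Theta(\mathsf B)\subset R\text{-}\mathrm{mod}$ be its essential image. Terminology. Let $\mathsf C\subset R\text{-}\mathrm{mod}$ be a full subcategory. - $\mathsf C$ is the right $0$-perpendicular subcategory to a class of morphisms $\mathsf F$ in $R\text{-}\mathrm{mod}$ if a module $C$ belongs to $\mathsf C$ if and only if $\mathrm{Hom}_R(f,C)\colon \mathrm{Hom}_R(U'',C)\to\mathrm{Hom}_R(U',C)$ is an isomorphism for every morphism $f\colon U'\to U''$ in $\mathsf F$. - $\mathsf C$ is the right $1$-perpendicular subcategory to a class of modules $\mathsf E$ if a module $C$ belongs to $\mathsf C$ if and only if $\mathrm{Hom}_R(E,C)=0=\mathrm{Ext}^1_R(E,C)$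 for all $E\in\mathsf E$. - For an integer $n\ge 1$ (resp. $n=\infty$), $\mathsf C$ is the right $n$-perpendicular subcategory to $\mathsf E$ if it is the right $1$-perpendicular subcategory to $\mathsf E$ and, moreover, $\mathrm{Ext}^i_R(E,C)=0$ for all $E\in\mathsf E$, $C\in\mathsf C$ and all integers $0\le i\le n$ (resp. all $i\ge 0$). Then: (a) $\Theta(\mathsf B)$ is the right $0$-perpendicular subcategory to some set of morphisms in $R\text{-}\mathrm{mod}$. Suppose in addition that $\theta$ is injective. Then: (b) $\Theta(\mathsf B)$ is the right $1$-perpendicular subcategory to some set of modules if and only if it is closed under extensions in $R\text{-}\mathrm{mod}$; likewise, $\Theta(\mathsf B)$ is the right $1$-perpendicular subcategory to some class of modules if and only if it is closed under extensions. (c) Let $n\ge 1$ be an integer. If the maps $\mathrm{Ext}^i_{\mathsf B}(B,C)\to\mathrm{Ext}^i_R(\Theta(B),\Theta(C))$ induced by $\Theta$ are isomorphisms for all $B,C\in\mathsf B$ and all $0\le i\le n$, then $\Theta(\mathsf B)$ is the right $n$-perpendicular subcategory to some set of modules. (d) If the maps $\mathrm{Ext}^i_{\mathsf B}(B,C)\to\mathrm{Ext}^i_R(\Theta(B),\Theta(C))$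 induced by $\Theta$ are isomorphisms for all $B,C\in\mathsf B$ and all $i\ge 0$, then $\Theta(\mathsf B)$ is the right $\infty$-perpendicular subcategory to some set of modules. -/

import Mathlib

open CategoryTheory CategoryTheory.Limits CategoryTheory.Abelian

universe w v v' u u'

namespace RightPerp

section Perpendicular

/-- `B` is the right `0`-perpendicular subcategory `F^{⊥₀}` to the class of morphisms `F`:
an object `X` lies in `B` iff `Hom(f, X) : Hom(U'', X) → Hom(U', X)` is bijective for
every `f : U' ⟶ U''` in `F`. -/
def IsRightZeroPerpTo {A : Type u} [Category.{v} A]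
    (B : ObjectProperty A) (F : MorphismProperty A) : Prop :=
  ∀ X : A, B X ↔ ∀ ⦃U' U'' : A⦄ (f : U' ⟶ U''), F f →
    Function.Bijective (fun g : U'' ⟶ X => f ≫ g)

/-- `B` is the right `1`-perpendicular subcategory `E^{⊥₀,₁}` to the class of objects `E`:
an object `X` lies in `B` iff `Hom(Y, X) = 0 = Ext¹(Y, X)` for every `Y` in `E`. -/
def IsRightOnePerpTo {A : Type u} [Category.{v} A] [Abelian A] [HasExt.{w} A]
    (B E : ObjectProperty A) : Prop :=
  ∀ X : A, B X ↔ ∀ Y : A, E Y → Subsingleton (Y ⟶ X) ∧ Subsingleton (Ext.{w} Y X 1)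

/-- For `1 ≤ n ≤ ∞`, `B` is the right `n`-perpendicular subcategory to the class of objects `E`:
it is the right `1`-perpendicular subcategory to `E`, and `Ext^i(Y, X) = 0` for all `Y` in `E`,
all `X` in `B` and all (finite) `0 ≤ i ≤ n`. -/
def IsRightPerpTo {A : Type u} [Category.{v} A] [Abelian A] [HasExt.{w} A]
    (n : ℕ∞) (B E : ObjectProperty A) : Prop :=
  IsRightOnePerpTo.{w} B E ∧
    ∀ Y X : A, E Y → B X → ∀ i : ℕ, (i : ℕ∞) ≤ n → Subsingleton (Ext.{w} Y X i)

end Perpendicular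

/-- The exact functor `F` induces an isomorphism
`Ext^i(X, Y) → Ext^i(F X, F Y)` for all objects `X`, `Y`.
(Here `Ext` is taken in the universe in which it exists for every abelian category;
it does not depend on this choice up to a bijection.) -/
def InducesExtIso {A : Type u} [Category.{v} A] [Abelian A] {D : Type u'} [Category.{v'} D]
    [Abelian D] (F : A ⥤ D) [F.Additive] [PreservesFiniteLimits F] [PreservesFiniteColimits F]
    (i : ℕ) : Prop :=
  have : HasExt.{max u v} A := HasExt.standard A
  have : HasExt.{max u' v'} D := HasExt.standard D
  ∀ X Y : A, Function.Bijective
    (F.mapExtAddHom X Y i : Ext.{max u v} X Y i →+ Ext.{max u' v'} (F.obj X) (F.obj Y) i)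

noncomputable section Theta

variable {B : Type u} [Category.{v} B] [Abelian B] (P : B) {R : Type v} [Ring R]
  (θ : R →+* (End P)ᵐᵒᵖ)

/-- The functor `Θ = Hom(P, -) : B ⥤ R-Mod`, where `r : R` acts on `Hom(P, X)` by precomposition
with the endomorphism `θ r` of `P`. -/
def homFunctor : B ⥤ ModuleCat.{v} R :=
  preadditiveCoyonedaObj P ⋙ ModuleCat.restrictScalars θ

theorem homFunctor_smul (X : B) (r : R) (f : (homFunctor P θ).obj X) :
    (r • f : (homFunctor P θ).obj X) = ((θ r).unop : P ⟶ P) ≫ (f : P ⟶ X) := rfl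

theorem homFunctor_map {X Y : B} (g : X ⟶ Y) (f : (homFunctor P θ).obj X) :
    (homFunctor P θ).map g f = (f : P ⟶ X) ≫ g := rfl

instance : (homFunctor P θ).Additive := by
  unfold homFunctor; infer_instance

instance [Projective P] : PreservesFiniteColimits (homFunctor P θ) := by
  unfold homFunctor; infer_instance

instance : PreservesFiniteLimits (homFunctor P θ) := by
  have : PreservesFiniteLimits (preadditiveCoyonedaObj P) := PreservesLimits.preservesFiniteLimits _
  have : PreservesFiniteLimits (ModuleCat.restrictScalars.{v} θ) :=
    ⟨fun _ _ _ => ⟨fun {_} => inferInstance⟩⟩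
  exact comp_preservesFiniteLimits _ _

end Theta

end RightPerp

/-!
A module lies in `Θ(B)` iff it is local with respect to the units `R^(X) ⟶ Θ(P^(X))`: a local
module has a two-term presentation by modules `Θ(P^(X))`, and since `Θ` is full and exact, it is the
image of a cokernel formed in `B`. If `P` is `κ`-presentable, both sides of the unit commute with
`κ`-filtered colimits in `X`, so the units of the subsets `X` of `κ` suffice.

If `θ` is injective then so are the units, because composing with the projections `P^(X) ⟶ P`
recovers the coordinates of an element of `R^(X)`. The long exact sequence then turns locality
into the vanishing of `Hom` and `Ext¹` out of the cokernels of the units, as soon as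
`Ext¹(Θ(P^(X)), -)` vanishes on `Θ(B)`. If `Θ(B)` is closed under extensions, it contains the middle
term `E` of any extension of `Θ(P^(X))` by an object of `Θ(B)`, and the unit lifts to a map
`R^(X) ⟶ E`, which extends to a splitting `Θ(P^(X)) ⟶ E` by locality. When `Θ` induces isomorphisms
on `Ext^i`, the vanishing is inherited from the projective object `P^(X)`, also for larger `i`.
-/

namespace RightPerp

section Local

variable {C : Type u} [Category.{v} C]

instance isStableUnderColimitsOfShape_isLocal (Q : ObjectProperty C) (J : Type u')
    [Category.{v'} J] : Q.isLocal.IsStableUnderColimitsOfShape J where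
  condition X₁ X₂ c₁ c₂ h₁ h₂ f hf φ hφ Z hZ := by
    refine ⟨fun g g' hg => h₂.hom_ext fun j => (hf j Z hZ).1 ?_, fun g => ?_⟩
    · simpa only [← Category.assoc, hφ] using congrArg (c₁.ι.app j ≫ ·) hg
    · choose app happ using fun j => (hf j Z hZ).2 (c₁.ι.app j ≫ g)
      dsimp only at happ
      refine ⟨h₂.desc (Cocone.mk Z { app := app, naturality := fun i j a => ?_ }),
        h₁.hom_ext fun j => ?_⟩
      · refine (hf i Z hZ).1 ?_
        simp [happ, ← f.naturality_assoc]
      · simp [reassoc_of% hφ, happ]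

lemma morphismProperty_app_of_isCardinalAccessible {W : MorphismProperty C} [W.RespectsIso]
    {F G : Type w ⥤ C} (τ : F ⟶ G) (κ : Cardinal.{w}) [Fact κ.IsRegular]
    [F.IsCardinalAccessible κ] [G.IsCardinalAccessible κ]
    [∀ X : Type w, W.IsStableUnderColimitsOfShape (HasCardinalLT.Set X κ)]
    (hτ : ∀ S : Set κ.ord.ToType, W (τ.app S)) (X : Type w) : W (τ.app X) := by
  have hτ' (A : Type w) (hA : HasCardinalLT A κ) : W (τ.app A) := by
    rw [hasCardinalLT_iff_cardinal_mk_lt, ← Cardinal.mk_ord_toType κ] at hA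
    obtain ⟨i⟩ := hA.le
    let e : A ≅ (Set.range i : Set κ.ord.ToType) := (Equiv.ofInjective i i.injective).toIso
    exact (W.arrow_mk_iso_iff (Arrow.isoMk (F.mapIso e) (G.mapIso e) (by simp))).2 (hτ _)
  -- `X` is the `κ`-filtered colimit of its subsets of cardinality `< κ`.
  have (H : Type w ⥤ C) [H.IsCardinalAccessible κ] :
      PreservesColimitsOfShape (HasCardinalLT.Set X κ) H :=
    H.preservesColimitsOfShape_of_isCardinalAccessible κ _
  let hX := HasCardinalLT.Set.isColimitCocone X κ (Cardinal.IsRegular.aleph0_le Fact.out)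
  exact MorphismProperty.IsStableUnderColimitsOfShape.condition _ _ _ _
    (isColimitOfPreserves F hX) (isColimitOfPreserves G hX)
    (Functor.whiskerLeft (HasCardinalLT.Set.functor X κ) τ) (fun A => hτ' _ A.2) (τ.app X)
    fun A => τ.naturality _

end Local

section EssImage

-- Choosing `U₁ ↠ ker (U₀ ↠ M)`, locality of `u₀` and `u₁` lifts `U₁ ⟶ U₀ ⟶ M ⟶ 0` to
-- `F X₁ ⟶ F X₀ ⟶ M ⟶ 0`, whose first map comes from some `d : X₁ ⟶ X₀`, so `M ≅ F (coker d)`.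
lemma le_essImage_of_epi_of_isLocal {C : Type u} [Category.{v} C] [HasZeroMorphisms C]
    [HasCokernels C] {D : Type u'} [Category.{v'} D] [Abelian D] (F : C ⥤ D) [F.Full]
    [F.PreservesZeroMorphisms] [PreservesColimitsOfShape WalkingParallelPair F]
    {Q : ObjectProperty D} (hF : F.essImage ≤ Q)
    (hQ : ∀ M : D, ∃ (U : D) (p : U ⟶ M) (_ : Epi p) (X : C) (u : U ⟶ F.obj X), Q.isLocal u) :
    Q ≤ F.essImage := fun M hM => by
  have hFQ (X : C) : Q (F.obj X) := hF _ (F.obj_mem_essImage X)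
  obtain ⟨U₀, p, _, X₀, u₀, hu₀⟩ := hQ M
  obtain ⟨U₁, p', _, X₁, u₁, hu₁⟩ := hQ (kernel p)
  have hp : IsColimit (CokernelCofork.ofπ p (by simp) : CokernelCofork (p' ≫ kernel.ι p)) :=
    isCokernelEpiComp (epiIsCokernelOfKernel _ (kernelIsKernel p)) p' rfl
  obtain ⟨q, hq : u₀ ≫ q = p⟩ := (hu₀ M hM).2 p
  obtain ⟨d', hd' : u₁ ≫ d' = (p' ≫ kernel.ι p) ≫ u₀⟩ := (hu₁ _ (hFQ X₀)).2 _
  obtain ⟨d, rfl⟩ := F.map_surjective d'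
  have hdq : F.map d ≫ q = 0 := (hu₁ M hM).1 (by simp [reassoc_of% hd', hq])
  let π := F.map (cokernel.π d)
  have hdπ : F.map d ≫ π = 0 := by rw [← F.map_comp, cokernel.condition, F.map_zero]
  have hπ : IsColimit (CokernelCofork.ofπ π hdπ) := isColimitOfHasCokernelOfPreservesColimit F d
  obtain ⟨j, hj : p ≫ j = u₀ ≫ π⟩ := CokernelCofork.IsColimit.desc' hp (u₀ ≫ π) <| by
    rw [← Category.assoc, ← hd', Category.assoc, hdπ, comp_zero]
  obtain ⟨k, hk : π ≫ k = q⟩ := CokernelCofork.IsColimit.desc' hπ q hdq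
  have : Epi π := Cofork.IsColimit.epi hπ
  have hqj : q ≫ j = π := (hu₀ _ (hFQ _)).1 (by simp [reassoc_of% hq, hj])
  refine ⟨cokernel d, ⟨⟨k, j, ?_, ?_⟩⟩⟩
  · rw [← cancel_epi π, reassoc_of% hk, hqj]
    exact (Category.comp_id _).symm
  · rw [← cancel_epi p, reassoc_of% hj, hk, hq, Category.comp_id]

end EssImage

section FreeUnit

instance projective_sigmaConst_obj {C : Type u} [Category.{v} C] [HasCoproducts.{v} C] (P : C)
    [Projective P] (X : Type v) : Projective ((sigmaConst.{v}.obj P).obj X) :=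
  inferInstanceAs (Projective (∐ fun _ : X => P))

variable {B : Type u} [Category.{v} B] [Abelian B] [HasCoproducts.{v} B] (P : B)
  {R : Type v} [Ring R] (θ : R →+* (End P)ᵐᵒᵖ)

/-- The unit `R^(X) ⟶ Θ(P^(X))` from the free module on a type `X` to its reflection in `Θ(B)`. It
sends a basis element to the corresponding inclusion of `P` into the copower `P^(X)`. -/
noncomputable def freeUnit : ModuleCat.free R ⟶ sigmaConst.{v}.obj P ⋙ homFunctor P θ where
  app X := ModuleCat.freeDesc (M := (homFunctor P θ).obj _) (↾fun x => Sigma.ι (fun _ : X => P) x)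
  naturality X Y f := by
    ext x
    simp only [ModuleCat.comp_apply, ModuleCat.free_map_apply, ModuleCat.freeDesc_apply]
    exact (by simp : Sigma.ι (fun _ : Y => P) (f x) =
      Sigma.ι (fun _ : X => P) x ≫ (sigmaConst.obj P).map f)

variable {P θ}

lemma freeUnit_app_freeMk {X : Type v} (x : X) :
    (freeUnit P θ).app X (ModuleCat.freeMk x) = Sigma.ι (fun _ : X => P) x :=
  ModuleCat.freeDesc_apply _ _

lemma isLocal_freeUnit_app [(homFunctor P θ).Full] (X : Type v) :
    (homFunctor P θ).essImage.isLocal ((freeUnit P θ).app X) := by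
  rintro M ⟨A, ⟨e⟩⟩
  rw [← MorphismProperty.isLocal_single_iff_bijective]
  refine ObjectProperty.prop_of_iso _ e
    ((MorphismProperty.isLocal_single_iff_bijective _ _).2 ⟨fun g g' h => ?_, fun g => ?_⟩)
  · obtain ⟨f, rfl⟩ := (homFunctor P θ).map_surjective g
    obtain ⟨f', rfl⟩ := (homFunctor P θ).map_surjective g'
    refine congrArg _ (Sigma.hom_ext _ _ fun x => ?_)
    have hx := ConcreteCategory.congr_hom h (ModuleCat.freeMk x)
    simpa only [ModuleCat.comp_apply, freeUnit_app_freeMk] using! hx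
  · refine ⟨(homFunctor P θ).map (Sigma.desc fun x => (g (ModuleCat.freeMk x) : P ⟶ A)),
      ModuleCat.free_hom_ext fun x => ?_⟩
    rw [ModuleCat.comp_apply, freeUnit_app_freeMk]
    exact Sigma.ι_desc _ x

instance (κ : Cardinal.{v}) [Fact κ.IsRegular] [IsCardinalPresentable P κ] :
    (homFunctor P θ).IsCardinalAccessible κ where
  preservesColimitOfShape J _ _ := by
    have := isFiltered_of_isCardinalFiltered J κ
    have : PreservesColimitsOfShape J (homFunctor P θ ⋙ forget (ModuleCat.{v} R)) :=
      (preservesColimitsOfShape_of_isCardinalPresentable P κ J)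
    exact preservesColimitsOfShape_of_reflects_of_preserves _ (forget (ModuleCat.{v} R))

theorem isRightZeroPerpTo_freeUnit [Projective P] [(homFunctor P θ).Full] (κ : Cardinal.{v})
    [Fact κ.IsRegular] [IsCardinalPresentable P κ] :
    IsRightZeroPerpTo (homFunctor P θ).essImage
      (.ofHoms fun S : Set κ.ord.ToType => (freeUnit P θ).app S) := by
  set W := MorphismProperty.ofHoms fun S : Set κ.ord.ToType => (freeUnit P θ).app S
  have hW : (homFunctor P θ).essImage ≤ W.isLocal :=
    (ObjectProperty.le_isLocal_iff _ _).1 fun _ _ _ ⟨S⟩ => isLocal_freeUnit_app S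
  have := (ModuleCat.adj R).leftAdjoint_preservesColimits
  have hunit : ∀ X, W.isLocal.isLocal ((freeUnit P θ).app X) :=
    morphismProperty_app_of_isCardinalAccessible (freeUnit P θ) κ fun S =>
      MorphismProperty.le_isLocal_isLocal W _ ⟨S⟩
  exact fun M => ⟨hW M, le_essImage_of_epi_of_isLocal _ hW (fun M =>
    ⟨_, (ModuleCat.adj R).counit.app M, inferInstance, _, _, hunit M⟩) M⟩

open Classical in
lemma freeUnit_app_comp_map_sigmaπ {X : Type v} (x : X) :
    (freeUnit P θ).app X ≫ (homFunctor P θ).map (Sigma.π (fun _ : X => P) x) =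
      ModuleCat.ofHom (LinearMap.toSpanSingleton R ((homFunctor P θ).obj P) (𝟙 P) ∘ₗ
        Finsupp.lapply x) := by
  refine ModuleCat.free_hom_ext fun y => ?_
  have hy : Sigma.ι (fun _ : X => P) y ≫ Sigma.π (fun _ : X => P) x =
      (θ (Finsupp.single y 1 x)).unop ≫ 𝟙 P := by
    obtain rfl | hyx := eq_or_ne y x
    · rw [Sigma.ι_π_eq_id, Finsupp.single_eq_same, map_one]
      exact (Category.comp_id _).symm
    · rw [Sigma.ι_π_of_ne _ hyx, Finsupp.single_eq_of_ne hyx.symm, map_zero]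
      exact zero_comp.symm
  rw [ModuleCat.comp_apply, freeUnit_app_freeMk]
  exact hy

lemma mono_freeUnit_app (hθ : Function.Injective θ) (X : Type v) :
    Mono ((freeUnit P θ).app X) := by
  classical
  have hcoord (x : X) (z : X →₀ R) : (homFunctor P θ).map (Sigma.π (fun _ : X => P) x)
      ((freeUnit P θ).app X z) = ((θ (z x)).unop : P ⟶ P) :=
    (ConcreteCategory.congr_hom (freeUnit_app_comp_map_sigmaπ x) z).trans (Category.comp_id _)
  refine ConcreteCategory.mono_of_injective _ fun z z' h => Finsupp.ext fun x => ?_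
  exact hθ <| MulOpposite.unop_injective <|
    (hcoord x z).symm.trans ((congrArg ((homFunctor P θ).map (Sigma.π _ x)) h).trans (hcoord x z'))

end FreeUnit

section Ext

variable {A : Type u} [Category.{v} A] [Abelian A]

lemma shortExact_of_isPushout {S : ShortComplex A} (hS : S.ShortExact) {M E : A}
    {φ : S.X₁ ⟶ M} {l : S.X₂ ⟶ E} {r : M ⟶ E} (h : IsPushout S.f φ l r) :
    (ShortComplex.mk r (h.desc S.g 0 (by simp)) (h.inr_desc _ _ _)).ShortExact := by
  have := hS.mono_f
  have := hS.epi_g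
  have hr : Mono r := (MorphismProperty.monomorphisms A).of_isPushout h.flip (.infer_property S.f)
  have hd : Epi (h.desc S.g 0 (by simp)) := epi_of_epi_fac (h.inl_desc _ _ _)
  refine ShortComplex.ShortExact.mk' (ShortComplex.exact_of_g_is_cokernel _ ?_) hr hd
  refine CokernelCofork.IsColimit.ofπ' _ _ fun {Z} k (hk : r ≫ k = 0) => ?_
  have hlk : S.f ≫ l ≫ k = 0 := by rw [h.w_assoc, hk, comp_zero]
  refine ⟨hS.exact.desc _ hlk, h.hom_ext ?_ ?_⟩
  · rw [h.inl_desc_assoc, hS.exact.g_desc]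
  · rw [h.inr_desc_assoc, zero_comp, hk]

lemma shortExact_cokernel {X Y : A} (g : X ⟶ Y) [Mono g] :
    (ShortComplex.mk g (cokernel.π g) (cokernel.condition g)).ShortExact :=
  .mk' (ShortComplex.cokernelSequence_exact g) ‹Mono g› inferInstance

variable [HasExt.{w} A]

lemma extClass_eq_zero_of_section {S : ShortComplex A} (hS : S.ShortExact) {s : S.X₃ ⟶ S.X₂}
    (hs : s ≫ S.g = 𝟙 S.X₃) : hS.extClass = (0 : Ext.{w} S.X₃ S.X₁ 1) := by
  rw [← Ext.mk₀_id_comp hS.extClass, ← hs, ← Ext.mk₀_comp_mk₀_assoc, hS.comp_extClass,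
    Ext.comp_zero]

lemma exists_shortExact_extClass_eq [EnoughProjectives A] {Z M : A} (x : Ext.{w} Z M 1) :
    ∃ (E : A) (i : M ⟶ E) (p : E ⟶ Z) (hip : i ≫ p = 0)
      (hS : (ShortComplex.mk i p hip).ShortExact), hS.extClass = x := by
  let S := ShortComplex.kernelSequence (Projective.π Z)
  have hS : S.ShortExact :=
    .mk' (ShortComplex.kernelSequence_exact _) inferInstance
      (inferInstanceAs (Epi (Projective.π Z)))
  have : Projective S.X₂ := inferInstanceAs (Projective (Projective.over Z))
  obtain ⟨y, rfl⟩ := Ext.contravariant_sequence_exact₃ hS M x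
    (Ext.eq_zero_of_projective (n := 0) _) (n₀ := 0) (add_zero 1)
  obtain ⟨φ, rfl⟩ := (Ext.mk₀_bijective _ _).2 y
  have h := IsPushout.of_hasPushout S.f φ
  have hT := shortExact_of_isPushout hS h
  let f : S ⟶ ShortComplex.mk _ _ (h.inr_desc S.g 0 (by simp)) :=
    { τ₁ := φ, τ₂ := pushout.inl _ _, τ₃ := 𝟙 Z, comm₁₂ := h.w.symm,
      comm₂₃ := (h.inl_desc _ _ _).trans (Category.comp_id _).symm }
  exact ⟨_, _, _, _, hT,
    (Ext.mk₀_id_comp _).symm.trans (hS.extClass_naturality hT f).symm⟩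

lemma subsingleton_ext_of_shortExact {S : ShortComplex A} (hS : S.ShortExact) (X : A) (n : ℕ)
    [Subsingleton (Ext.{w} X S.X₁ n)] [Subsingleton (Ext.{w} X S.X₃ n)] :
    Subsingleton (Ext.{w} X S.X₂ n) :=
  subsingleton_of_forall_eq 0 fun x => by
    obtain ⟨y, rfl⟩ := Ext.covariant_sequence_exact₂ X hS x (Subsingleton.elim _ _)
    rw [Subsingleton.elim y 0, Ext.zero_comp]

lemma bijective_comp_of_subsingleton {S : ShortComplex A} (hS : S.ShortExact) {Y : A}
    (h₀ : Subsingleton (S.X₃ ⟶ Y)) (h₁ : Subsingleton (Ext.{w} S.X₃ Y 1)) :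
    Function.Bijective fun g : S.X₂ ⟶ Y => S.f ≫ g := by
  have := hS.epi_g
  refine ⟨fun g g' hg => ?_, fun y => ?_⟩
  · have h : S.f ≫ (g - g') = 0 := by
      rw [Preadditive.comp_sub, sub_eq_zero]
      exact hg
    rw [← sub_eq_zero, ← hS.exact.g_desc _ h, Subsingleton.elim (hS.exact.desc _ h) 0, comp_zero]
  · obtain ⟨x, hx⟩ := Ext.contravariant_sequence_exact₁ hS Y (Ext.mk₀ y) rfl
      (Subsingleton.elim _ _)
    obtain ⟨g, rfl⟩ := (Ext.mk₀_bijective _ _).2 x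
    refine ⟨g, (Ext.mk₀_bijective _ _).1 ?_⟩
    rwa [Ext.mk₀_comp_mk₀] at hx

lemma subsingleton_of_bijective_comp {S : ShortComplex A} (hS : S.ShortExact) {Y : A}
    (h : Function.Bijective fun g : S.X₂ ⟶ Y => S.f ≫ g)
    [Subsingleton (Ext.{w} S.X₂ Y 1)] :
    Subsingleton (S.X₃ ⟶ Y) ∧ Subsingleton (Ext.{w} S.X₃ Y 1) := by
  have := hS.epi_g
  refine ⟨subsingleton_of_forall_eq 0 fun k => ?_, subsingleton_of_forall_eq 0 fun x => ?_⟩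
  · rw [← cancel_epi S.g]
    exact h.1 (by simp)
  · obtain ⟨y, rfl⟩ := Ext.contravariant_sequence_exact₃ hS Y x (Subsingleton.elim _ _)
      (n₀ := 0) (add_zero 1)
    obtain ⟨y, rfl⟩ := (Ext.mk₀_bijective _ _).2 y
    obtain ⟨g, rfl⟩ := h.2 y
    rw [← Ext.mk₀_comp_mk₀]
    exact hS.extClass_comp_assoc _

lemma subsingleton_ext_of_shortExact_of_projective {S : ShortComplex A} (hS : S.ShortExact)
    [Projective S.X₁] (Y : A) (n : ℕ) [Subsingleton (Ext.{w} S.X₂ Y (n + 2))] :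
    Subsingleton (Ext.{w} S.X₃ Y (n + 2)) :=
  subsingleton_of_forall_eq 0 fun x => by
    obtain ⟨y, rfl⟩ := Ext.contravariant_sequence_exact₃ hS Y x (Subsingleton.elim _ _)
      (add_comm 1 (n + 1))
    rw [Ext.eq_zero_of_projective y, Ext.comp_zero]

lemma subsingleton_ext_one_of_isLocal [EnoughProjectives A] {Q : ObjectProperty A}
    (hQ : Q.IsClosedUnderExtensions) {U Z M : A} [Projective U] {u : U ⟶ Z} (hu : Q.isLocal u)
    (hZ : Q Z) (hM : Q M) : Subsingleton (Ext.{w} Z M 1) := by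
  refine subsingleton_of_forall_eq 0 fun x => ?_
  obtain ⟨E, i, p, hip, hS, rfl⟩ := exists_shortExact_extClass_eq x
  have : Epi p := hS.epi_g
  obtain ⟨s, hs : u ≫ s = Projective.factorThru u p⟩ :=
    (hu E (hQ.prop_X₂_of_shortExact hS hM hZ)).2 _
  exact extClass_eq_zero_of_section hS (s := s) ((hu Z hZ).1 (by simp [reassoc_of% hs]))

end Ext

section Perp

variable {A : Type u} [Category.{v} A] [Abelian A] [HasExt.{w} A]

lemma IsRightOnePerpTo.isClosedUnderExtensions {Q E : ObjectProperty A}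
    (h : IsRightOnePerpTo.{w} Q E) : Q.IsClosedUnderExtensions where
  prop_X₂_of_shortExact {S} hS h₁ h₃ := (h S.X₂).2 fun Y hY => by
    obtain ⟨_, _⟩ := (h S.X₁).1 h₁ Y hY
    obtain ⟨_, _⟩ := (h S.X₃).1 h₃ Y hY
    have (X : A) [Subsingleton (Y ⟶ X)] : Subsingleton (Ext.{w} Y X 0) :=
      Ext.homEquiv₀.subsingleton
    have := subsingleton_ext_of_shortExact.{w} hS Y 0
    exact ⟨Ext.homEquiv₀.{w}.symm.subsingleton, subsingleton_ext_of_shortExact hS Y 1⟩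

variable {ι : Type*} {U V : ι → A} (f : ∀ i, U i ⟶ V i) {Q : ObjectProperty A}

lemma IsRightZeroPerpTo.isRightOnePerpTo_cokernel [∀ i, Mono (f i)]
    (hQ : IsRightZeroPerpTo Q (.ofHoms f))
    (hV : ∀ i X, Q X → Subsingleton (Ext.{w} (V i) X 1)) :
    IsRightOnePerpTo.{w} Q (.ofObj fun i => cokernel (f i)) := fun X => by
  refine ⟨fun hX => ?_, fun hX => (hQ X).2 ?_⟩
  · rintro _ ⟨i⟩
    have := hV i X hX
    exact subsingleton_of_bijective_comp (shortExact_cokernel (f i)) ((hQ X).1 hX _ ⟨i⟩)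
  · rintro _ _ _ ⟨i⟩
    obtain ⟨h₀, h₁⟩ := hX _ ⟨i⟩
    exact bijective_comp_of_subsingleton (shortExact_cokernel (f i)) h₀ h₁

lemma IsRightZeroPerpTo.isRightPerpTo_cokernel [∀ i, Mono (f i)] [∀ i, Projective (U i)]
    (hQ : IsRightZeroPerpTo Q (.ofHoms f)) {n : ℕ∞} (hn : 1 ≤ n)
    (hV : ∀ i X, Q X → ∀ k : ℕ, (k + 1 : ℕ) ≤ n → Subsingleton (Ext.{w} (V i) X (k + 1))) :
    IsRightPerpTo.{w} n Q (.ofObj fun i => cokernel (f i)) := by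
  have hQ₁ := hQ.isRightOnePerpTo_cokernel f fun i X hX => hV i X hX 0 hn
  refine ⟨hQ₁, ?_⟩
  rintro _ X ⟨i⟩ hX k hk
  obtain ⟨_, _⟩ := (hQ₁ X).1 hX _ ⟨i⟩
  match k with
  | 0 => exact Ext.homEquiv₀.subsingleton
  | 1 => assumption
  | k + 2 =>
    have := hV i X hX (k + 1) hk
    exact subsingleton_ext_of_shortExact_of_projective (shortExact_cokernel (f i)) X k

end Perp

section CokernelFreeUnit

lemma InducesExtIso.subsingleton_ext {C : Type u} [Category.{v} C] [Abelian C]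
    {D : Type u'} [Category.{v'} D] [Abelian D] [HasExt.{w} D] {F : C ⥤ D} [F.Additive]
    [PreservesFiniteLimits F] [PreservesFiniteColimits F] {i : ℕ} (h : InducesExtIso F (i + 1))
    (X : C) [Projective X] {M : D} (hM : F.essImage M) :
    Subsingleton (Ext.{w} (F.obj X) M (i + 1)) := by
  have : HasExt.{max u v} C := HasExt.standard C
  have : HasExt.{max u' v'} D := HasExt.standard D
  obtain ⟨Y, ⟨e⟩⟩ := hM
  have := Ext.subsingleton_of_projective.{max u v} X Y i
  have := (h X Y).2.subsingleton
  have : Subsingleton ((extFunctorObj.{w} (F.obj X) (i + 1)).obj (F.obj Y)) :=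
    Ext.chgUniv.{max u' v', w}.subsingleton
  exact ((extFunctorObj _ _).mapIso e).addCommGroupIsoToAddEquiv.symm.toEquiv.subsingleton

variable {B : Type u} [Category.{v} B] [Abelian B] [HasCoproducts.{v} B] {P : B} [Projective P]
  {R : Type v} [Ring R] {θ : R →+* (End P)ᵐᵒᵖ} [(homFunctor P θ).Full]
  (κ : Cardinal.{v}) [Fact κ.IsRegular] [IsCardinalPresentable P κ]

lemma isRightOnePerpTo_cokernel_freeUnit (hθ : Function.Injective θ)
    (hC : (homFunctor P θ).essImage.IsClosedUnderExtensions) :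
    IsRightOnePerpTo.{v} (homFunctor P θ).essImage
      (.ofObj fun S : Set κ.ord.ToType => cokernel ((freeUnit P θ).app S)) := by
  have (S : Set κ.ord.ToType) : Mono ((freeUnit P θ).app S) := mono_freeUnit_app hθ S
  exact (isRightZeroPerpTo_freeUnit κ).isRightOnePerpTo_cokernel _ fun S _ =>
    subsingleton_ext_one_of_isLocal hC (isLocal_freeUnit_app S) (Functor.obj_mem_essImage _ _)

lemma isRightPerpTo_cokernel_freeUnit (hθ : Function.Injective θ) {n : ℕ∞} (hn : 1 ≤ n)
    (hExt : ∀ i : ℕ, i ≤ n → InducesExtIso (homFunctor P θ) i) :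
    IsRightPerpTo.{v} n (homFunctor P θ).essImage
      (.ofObj fun S : Set κ.ord.ToType => cokernel ((freeUnit P θ).app S)) := by
  have (S : Set κ.ord.ToType) : Mono ((freeUnit P θ).app S) := mono_freeUnit_app hθ S
  exact (isRightZeroPerpTo_freeUnit κ).isRightPerpTo_cokernel _ hn fun S _ hM k hk =>
    (hExt (k + 1) hk).subsingleton_ext ((sigmaConst.obj P).obj S) hM

end CokernelFreeUnit

lemma hasCoproducts_of_isLocallyPresentable (C : Type u) [Category.{v} C]
    [IsLocallyPresentable.{w} C] : HasCoproducts.{w} C := by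
  obtain ⟨κ, _, _⟩ := IsLocallyPresentable.exists_cardinal.{w} C
  have : HasColimitsOfSize.{w, w} C := IsCardinalLocallyPresentable.toHasColimitsOfSize κ
  exact fun _ => inferInstance

end RightPerp

theorem mainTheorem3_general {B : Type u} [Category.{v} B] [Abelian B] [HasCoproducts.{v} B]
    (P : B) [Projective P] [IsPresentable.{v} P] {R : Type v} [Ring R] (θ : R →+* (End P)ᵐᵒᵖ)
    [(RightPerp.homFunctor P θ).Full] :
    (∃ F : MorphismProperty (ModuleCat.{v} R), MorphismProperty.IsSmall.{v} F ∧
      RightPerp.IsRightZeroPerpTo (RightPerp.homFunctor P θ).essImage F) ∧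
    (Function.Injective θ →
      ((∃ E : ObjectProperty (ModuleCat.{v} R), ObjectProperty.Small.{v} E ∧
          RightPerp.IsRightOnePerpTo.{v} (RightPerp.homFunctor P θ).essImage E) ↔
        (RightPerp.homFunctor P θ).essImage.IsClosedUnderExtensions) ∧
      ((∃ E : ObjectProperty (ModuleCat.{v} R),
          RightPerp.IsRightOnePerpTo.{v} (RightPerp.homFunctor P θ).essImage E) ↔
        (RightPerp.homFunctor P θ).essImage.IsClosedUnderExtensions) ∧
      (∀ n : ℕ, 1 ≤ n → (∀ i : ℕ, i ≤ n → RightPerp.InducesExtIso (RightPerp.homFunctor P θ) i) →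
        ∃ E : ObjectProperty (ModuleCat.{v} R), ObjectProperty.Small.{v} E ∧
          RightPerp.IsRightPerpTo.{v} n (RightPerp.homFunctor P θ).essImage E) ∧
      ((∀ i : ℕ, RightPerp.InducesExtIso (RightPerp.homFunctor P θ) i) →
        ∃ E : ObjectProperty (ModuleCat.{v} R), ObjectProperty.Small.{v} E ∧
          RightPerp.IsRightPerpTo.{v} ⊤ (RightPerp.homFunctor P θ).essImage E)) := by
  obtain ⟨κ, _, hκ⟩ := Functor.IsAccessible.exists_cardinal.{v} (F := coyoneda.obj (Opposite.op P))
  have : IsCardinalPresentable P κ := hκ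
  let u (S : Set κ.ord.ToType) := (RightPerp.freeUnit P θ).app S
  let E := ObjectProperty.ofObj fun S => cokernel (u S)
  have hE : ObjectProperty.Small.{v} E := inferInstance
  refine ⟨⟨.ofHoms u, inferInstance, RightPerp.isRightZeroPerpTo_freeUnit κ⟩, fun hθ => ?_⟩
  have hE₁ := RightPerp.isRightOnePerpTo_cokernel_freeUnit κ hθ
  exact ⟨⟨fun ⟨_, _, h⟩ => h.isClosedUnderExtensions, fun hC => ⟨E, hE, hE₁ hC⟩⟩,
    ⟨fun ⟨_, h⟩ => h.isClosedUnderExtensions, fun hC => ⟨E, hE₁ hC⟩⟩,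
    fun n hn h => ⟨E, hE, RightPerp.isRightPerpTo_cokernel_freeUnit κ hθ (by exact_mod_cast hn)
      fun i hi => h i (by exact_mod_cast hi)⟩,
    fun h => ⟨E, hE, RightPerp.isRightPerpTo_cokernel_freeUnit κ hθ le_top fun i _ => h i⟩⟩

theorem mainTheorem3 {B : Type u} [Category.{v} B] [Abelian B] [IsLocallyPresentable.{v} B]
    (P : B) [Projective P] (hP : IsSeparator P) {R : Type v} [Ring R]
    (θ : R →+* (End P)ᵐᵒᵖ)
    (hfull : (RightPerp.homFunctor P θ).Full)
    (hfaithful : (RightPerp.homFunctor P θ).Faithful) :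
    -- (a)
    (∃ F : MorphismProperty (ModuleCat.{v} R), MorphismProperty.IsSmall.{v} F ∧
      RightPerp.IsRightZeroPerpTo (RightPerp.homFunctor P θ).essImage F) ∧
    (Function.Injective θ →
      -- (b), for sets and for classes of objects
      ((∃ E : ObjectProperty (ModuleCat.{v} R), ObjectProperty.Small.{v} E ∧
          RightPerp.IsRightOnePerpTo.{v} (RightPerp.homFunctor P θ).essImage E) ↔
        (RightPerp.homFunctor P θ).essImage.IsClosedUnderExtensions) ∧
      ((∃ E : ObjectProperty (ModuleCat.{v} R),
          RightPerp.IsRightOnePerpTo.{v} (RightPerp.homFunctor P θ).essImage E) ↔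
        (RightPerp.homFunctor P θ).essImage.IsClosedUnderExtensions) ∧
      -- (c)
      (∀ n : ℕ, 1 ≤ n → (∀ i : ℕ, i ≤ n → RightPerp.InducesExtIso (RightPerp.homFunctor P θ) i) →
        ∃ E : ObjectProperty (ModuleCat.{v} R), ObjectProperty.Small.{v} E ∧
          RightPerp.IsRightPerpTo.{v} n (RightPerp.homFunctor P θ).essImage E) ∧
      -- (d)
      ((∀ i : ℕ, RightPerp.InducesExtIso (RightPerp.homFunctor P θ) i) →
        ∃ E : ObjectProperty (ModuleCat.{v} R), ObjectProperty.Small.{v} E ∧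
          RightPerp.IsRightPerpTo.{v} ⊤ (RightPerp.homFunctor P θ).essImage E)) := by
  have := RightPerp.hasCoproducts_of_isLocallyPresentable.{v} B
  exact mainTheorem3_general P θ
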